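/- **Setting.** There are $n$ parties, at most $f$ of them (with $3f<n$, e.g. $n=3f+1$) are statically corrupted and behave arbitrarily; the network is asynchronous, an adversary schedules all events, and channels are authenticated (a message received from an honest party was sent by it). A block is a tuple $\langle epoch, slot, \mathsf{TXs}, \mathsf{Proof}\rangle$. Fix an epoch $e$ (it may depend on the security parameter, as may $n,f$). All honest parties enter it with one and the same $\mathsf{log}$, whose blocks belong to earlier epochs, and with $1\text{-}\mathsf{notarized}=2\text{-}\mathsf{notarized}=\emptyset$, $S=\emptyset$. An honest party runs the following part of the Bolt-Dumbo Transformer protocol. * When $\mathsf{Bolt}[e]$ delivers a block none of whose transactions occurs in $\mathsf{log}$, $2\text{-}\mathsf{notarized}$ or $1\text{-}\mathsf{notarized}$: a non-empty $2\text{-}\mathsf{notarized}$ is appended to $\mathsf{log}$ (finalized), then $2\text{-}\mathsf{notarized}\leftarrow 1\text{-}\mathsf{notarized}$, and $1\text{-}\mathsf{notarized}$ becomes the delivered block. (Other delivered blocks are ignored.) * When interrupted (which may happen at any time): it invokes $\mathsf{abandon}(e)$ and multicasts, once, $\textsc{PaceSync}(e,p,\mathsf{Proof}_p)$, where $p$ and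 $\mathsf{Proof}_p$ are the slot and the proof of its $1\text{-}\mathsf{notarized}$ block ($p=0$ without a proof if this is empty). * On the first $\textsc{PaceSync}(e,p_j,\mathsf{Proof})$ message from a party $\mathcal P_j$: if $\mathsf{Bolt.Verify}(e,p_j,\mathsf{Proof})=1$ (or $p_j=0$ with no proof), it records $p_j$ in $S$ (one entry per sender). When slots of $n-f$ distinct parties are recorded ($2f+1$ of them if $n=3f+1$), it enters the Transformer phase and inputs $\mathsf{maxpace}_e=\max S$ to $\mathsf{tcv\text{-}BA}[e]$. * When $\mathsf{tcv\text{-}BA}[e]$ then returns $v$, it obtains $\mathsf{pace}_e=\max(v-1,0)$. If $\mathsf{pace}_e>0$, $2\text{-}\mathsf{notarized}\neq\emptyset$ and $p$ is the slot of its $1\text{-}\mathsf{notarized}$ block, it appends to $\mathsf{log}$ its $2\text{-}\mathsf{notarized}$ block if $\mathsf{pace}_e=p-1$, and its $2\text{-}\mathsf{notarized}$ and then its $1\text{-}\mathsf{notarized}$ block if $\mathsf{pace}_e\ge p$. (The subsequent calls for missing blocks and of the pessimistic path come after this point.) **Building blocks.** $\mathsf{Bolt}[e]$ is a notarizable weak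 atomic broadcast, i.e. the following hold except with negligible probability. A block is *valid* if its epoch is $e$ and $\mathsf{Bolt.Verify}$ accepts its slot and proof; the $j$-th output of an honest party ($j\ge1$) is a valid block with slot $j$. *Total order*: the $j$-th outputs of any two honest parties coincide if both exist. *Notarizability*: when any party, honest or corrupted, outputs a valid block with slot $j\ge 2$, at least $f+1$ honest parties have already output a valid block with slot $j-1$. *Abandonability*: an honest party that has invoked $\mathsf{abandon}(e)$ delivers nothing any more, and once $f+1$ honest parties have invoked $\mathsf{abandon}(e)$, no party delivers a valid block. $\mathsf{tcv\text{-}BA}[e]$ is a two-consecutive-value Byzantine agreement, i.e. the following hold except with negligible probability. *Strong validity*: a value output by an honest party was input by an honest party. *Termination*: if all honest parties input values in $\{v,v+1\}$ for some $v\ge 0$, every honest party outputs a value. *Agreement*: any two outputs of honest parties are equal. **Lemma.** Except with negligible probability in the security parameter: 1. whenever an honest party obtains $\mathsf{pace}_e$ and its latest finalized block $\mathsf{log}[-1]$ at that moment belongs to epoch $e$, the slot of this block is at most $\mathsf{pace}_e$; 2. no finalized block is ever revoked: in the execution of the steps above, no block is ever removed from the $\mathsf{log}$ of an honest party (earlier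 values of the $\mathsf{log}$ are prefixes of later ones), and every block of epoch $e$ that any honest party has in its $\mathsf{log}$ at any time has a slot at most the $\mathsf{pace}_e$ obtained by any honest party. -/

import Mathlib

namespace BDT

/-- A block `⟨epoch, slot, TXs, Proof⟩`. -/
structure Block (Tx Pf : Type*) where
  epoch : ℕ
  slot : ℕ
  txs : List Tx
  proof : Pf

/-- The size `n` of the system, the bound `f` on the number of corrupted parties (optimal
resilience), and the number `e` of the epoch under consideration. The quorum of the protocol is
`n - f`, which is `2 f + 1` when `n = 3 f + 1`. -/
structure Params where
  n : ℕ
  f : ℕ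
  e : ℕ
  resilience : 3 * f < n

/-- What can happen at a party in epoch `e`. The scheduling of all events is up to the adversary. -/
inductive Event (n : ℕ) (Tx Pf : Type*) where
  /-- `Bolt[e]` outputs the block `b` at party `i` (for a corrupted `i`: the party outputs `b`). -/
  | deliver (i : Fin n) (b : Block Tx Pf)
  /-- Party `i` is interrupted: its timer expires (timers are driven by clock ticks that the
  adversary schedules), or the epoch is complete, or its oldest transaction waited too long. -/
  | interrupt (i : Fin n)
  /-- Party `i` receives the message `PaceSync(e, p, π)` from party `j`. -/
  | recvPace (i j : Fin n) (p : ℕ) (π : Option Pf)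
  /-- `tcv-BA[e]` returns `v` at party `i`. -/
  | tcvReturn (i : Fin n) (v : ℕ)
  /-- Nothing happens. -/
  | idle

/-- The local variables of a party in epoch `e`. -/
structure LocalState (n : ℕ) (Tx Pf : Type*) where
  /-- the finalized output of the atomic broadcast -/
  log : List (Block Tx Pf)
  /-- `2-notarized` (`none` is `∅`) -/
  two : Option (Block Tx Pf)
  /-- `1-notarized` (`none` is `∅`) -/
  one : Option (Block Tx Pf)
  /-- the slot and proof in the `PaceSync` message that the party multicast when it invoked
  `abandon(e)`; `none` as long as it has not abandoned -/
  paceMsg : Option (ℕ × Option Pf)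
  /-- the parties from which a `PaceSync` message has been received -/
  heard : Finset (Fin n)
  /-- the valid slot numbers received, with their senders -/
  S : Finset (Fin n × ℕ)
  /-- `maxpace_e`, the input to `tcv-BA[e]`, once the party is in the Transformer phase -/
  maxpace : Option ℕ
  /-- `pace_e`, once it has been obtained -/
  pace : Option ℕ

section Protocol

variable {n : ℕ} {Tx Pf : Type*}

/-- The local state in which a party enters the Bolt phase with the log `log₀`. -/
def LocalState.init (log₀ : List (Block Tx Pf)) : LocalState n Tx Pf where
  log := log₀
  two := none
  one := none
  paceMsg := none
  heard := ∅
  S := ∅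
  maxpace := none
  pace := none

/-- The transactions in `log`, `2-notarized` and `1-notarized`. -/
def LocalState.knownTxs (s : LocalState n Tx Pf) : List Tx :=
  (s.log ++ s.two.toList ++ s.one.toList).flatMap Block.txs

/-- Upon `Bolt[e]` delivers a block: if all its transactions are new, the block becomes
`1-notarized`, the previous `1-notarized` becomes `2-notarized`, and the previous `2-notarized`,
if there is one, is finalized. -/
def LocalState.onDeliver [DecidableEq Tx] (s : LocalState n Tx Pf) (b : Block Tx Pf) :
    LocalState n Tx Pf :=
  if ∀ tx ∈ b.txs, tx ∉ s.knownTxs then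
    match s.two with
    | none => { s with two := s.one, one := some b }
    | some c => { s with log := s.log ++ [c], two := s.one, one := some b }
  else s

/-- The pace of a party and its proof: the slot number and proof of `1-notarized`; pace `0`, which
needs no proof, if `1-notarized` is empty. -/
def LocalState.currentPace (s : LocalState n Tx Pf) : ℕ × Option Pf :=
  match s.one with
  | none => (0, none)
  | some b => (b.slot, some b.proof)

/-- Upon an interruption: invoke `abandon(e)` and multicast `PaceSync` (once). -/
def LocalState.onInterrupt (s : LocalState n Tx Pf) : LocalState n Tx Pf :=
  match s.paceMsg with
  | none => { s with paceMsg := some s.currentPace }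
  | some _ => s

/-- The check that a receiver applies to a slot number and its proof. -/
def validPace (verify : ℕ → ℕ → Pf → Bool) (e p : ℕ) : Option Pf → Bool
  | none => p == 0
  | some π => verify e p π

/-- Record a valid slot number `p` from party `j`. When valid slot numbers from `quorum` distinct
parties have been recorded, enter the Transformer phase and input their maximum to `tcv-BA[e]`. -/
def LocalState.record (quorum : ℕ) (s : LocalState n Tx Pf) (j : Fin n) (p : ℕ) :
    LocalState n Tx Pf :=
  let S' := insert (j, p) s.S
  if S'.card = quorum then { s with S := S', maxpace := some (S'.sup Prod.snd) }
  else { s with S := S' }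

/-- Upon receiving `PaceSync(e, p, π)` from party `j` for the first time. -/
def LocalState.onPace (verify : ℕ → ℕ → Pf → Bool) (e quorum : ℕ) (s : LocalState n Tx Pf)
    (j : Fin n) (p : ℕ) (π : Option Pf) : LocalState n Tx Pf :=
  if j ∈ s.heard then s
  else
    let s' := { s with heard := insert j s.heard }
    if validPace verify e p π then s'.record quorum j p else s'

/-- The blocks that a party itself appends to its log in the Transformer phase, given its pace: its
`2-notarized` if the pace is one less than the slot of its `1-notarized`, and both if the pace is at
least that slot. -/
def LocalState.syncBlocks (s : LocalState n Tx Pf) (pace : ℕ) : List (Block Tx Pf) :=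
  match s.two, s.one with
  | some c, some b =>
    if pace = 0 then []
    else if pace + 1 = b.slot then [c]
    else if b.slot ≤ pace then [c, b]
    else []
  | _, _ => []

/-- Upon `tcv-BA[e]` returns `v` to a party that is waiting for it in the Transformer phase:
`pace_e ← max(v - 1, 0)` (truncated subtraction), and sync the log with the blocks at hand. The
calls of `Dumbo` (pace `0`) and `CallHelp` (blocks not at hand) come after that; they do not change
`pace_e` and are not part of this model. -/
def LocalState.onReturn (s : LocalState n Tx Pf) (v : ℕ) : LocalState n Tx Pf :=
  match s.maxpace, s.pace with
  | some _, none => { s with pace := some (v - 1), log := s.log ++ s.syncBlocks (v - 1) }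
  | _, _ => s

/-- The effect of an event on the local state of party `i`. -/
def LocalState.step [DecidableEq Tx] (verify : ℕ → ℕ → Pf → Bool) (e quorum : ℕ) (i : Fin n)
    (s : LocalState n Tx Pf) : Event n Tx Pf → LocalState n Tx Pf
  | .deliver k b => if k = i then s.onDeliver b else s
  | .interrupt k => if k = i then s.onInterrupt else s
  | .recvPace k j p π => if k = i then s.onPace verify e quorum j p π else s
  | .tcvReturn k v => if k = i then s.onReturn v else s
  | .idle => s

end Protocol

/-- The data of an execution of epoch `e`: the honest parties, the function `Bolt.Verify` (which
depends on the keys set up), the log with which the honest parties enter the epoch, and the events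
in the order in which they happen. -/
structure Execution (par : Params) (Tx Pf : Type*) where
  honest : Finset (Fin par.n)
  verify : ℕ → ℕ → Pf → Bool
  log₀ : List (Block Tx Pf)
  event : ℕ → Event par.n Tx Pf

namespace Execution

variable {par : Params} {Tx Pf : Type*} [DecidableEq Tx]

/-- The local state of party `i` just before the `t`-th event. It is meaningful for honest `i`;
corrupted parties behave arbitrarily. -/
def state (X : Execution par Tx Pf) : ℕ → Fin par.n → LocalState par.n Tx Pf
  | 0, _ => .init X.log₀
  | t + 1, i => (X.state t i).step X.verify par.e (par.n - par.f) i (X.event t)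

/-- The output of `Bolt[e]` at party `i` before the `t`-th event. -/
def boltLog (X : Execution par Tx Pf) : ℕ → Fin par.n → List (Block Tx Pf)
  | 0, _ => []
  | t + 1, i =>
    match X.event t with
    | .deliver k b => if k = i then X.boltLog t i ++ [b] else X.boltLog t i
    | _ => X.boltLog t i

/-- Party `i` has invoked `abandon(e)` before the `t`-th event. -/
def Abandoned (X : Execution par Tx Pf) (t : ℕ) (i : Fin par.n) : Prop :=
  (X.state t i).paceMsg.isSome

/-- A block of `Bolt[e]` with a valid proof. -/
def ValidBlock (X : Execution par Tx Pf) (b : Block Tx Pf) : Prop :=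
  b.epoch = par.e ∧ X.verify par.e b.slot b.proof = true

/-- The rules of the system model: at most `f` parties are corrupted, the messages of honest
parties cannot be forged (a `PaceSync` message received from an honest party is the one it sent),
and the honest parties enter the epoch with a log of blocks of earlier epochs. -/
structure Admissible (X : Execution par Tx Pf) : Prop where
  corrupted_le : X.honestᶜ.card ≤ par.f
  authenticated : ∀ t i j p π, i ∈ X.honest → j ∈ X.honest → X.event t = .recvPace i j p π →
    (X.state t j).paceMsg = some (p, π)
  earlier : ∀ b ∈ X.log₀, b.epoch < par.e

/-- In the execution, `Bolt[e]` meets the requirements on a notarizable weak atomic broadcast. -/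
structure BoltSecure (X : Execution par Tx Pf) : Prop where
  /-- The block at the `k`-th position (`k ≥ 1`) of an honest output is a valid block with slot
  number `k`. -/
  wellFormed : ∀ i ∈ X.honest, ∀ t (k : ℕ) (b : Block Tx Pf), (X.boltLog t i)[k]? = some b →
    X.ValidBlock b ∧ b.slot = k + 1
  totalOrder : ∀ i ∈ X.honest, ∀ j ∈ X.honest, ∀ t t' (k : ℕ) (b b' : Block Tx Pf),
    (X.boltLog t i)[k]? = some b → (X.boltLog t' j)[k]? = some b' → b = b'
  /-- When any party, honest or corrupted, outputs a valid block with slot number `j ≥ 2`, then at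
  least `f + 1` honest parties have already output a valid block with slot number `j - 1`. -/
  notarizability : ∀ t q b, X.event t = .deliver q b → X.ValidBlock b → 2 ≤ b.slot →
    ∃ Q ⊆ X.honest, par.f + 1 ≤ Q.card ∧
      ∀ k ∈ Q, ∃ b' ∈ X.boltLog t k, X.ValidBlock b' ∧ b'.slot + 1 = b.slot
  /-- An honest party that has invoked `abandon(e)` delivers nothing any more. -/
  abandon_self : ∀ t, ∀ i ∈ X.honest, X.Abandoned t i → ∀ b, X.event t ≠ .deliver i b
  /-- Once `f + 1` honest parties have invoked `abandon(e)`, no party delivers a valid block. -/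
  abandon_all : ∀ t, ∀ Q ⊆ X.honest, par.f + 1 ≤ Q.card → (∀ k ∈ Q, X.Abandoned t k) →
    ∀ q b, X.event t = .deliver q b → ¬ X.ValidBlock b

/-- Party `i` inputs `v` to `tcv-BA[e]`. -/
def TcvInput (X : Execution par Tx Pf) (i : Fin par.n) (v : ℕ) : Prop :=
  ∃ t, (X.state t i).maxpace = some v

/-- `tcv-BA[e]` outputs `v` at party `i`. -/
def TcvOutput (X : Execution par Tx Pf) (i : Fin par.n) (v : ℕ) : Prop :=
  ∃ t, X.event t = .tcvReturn i v

/-- In the execution, `tcv-BA[e]` meets the requirements on a two-consecutive-value Byzantine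
agreement. -/
structure TcvBASecure (X : Execution par Tx Pf) : Prop where
  strongValidity : ∀ i ∈ X.honest, ∀ v, X.TcvOutput i v → ∃ k ∈ X.honest, X.TcvInput k v
  termination : ∀ v, (∀ i ∈ X.honest, X.TcvInput i v ∨ X.TcvInput i (v + 1)) →
    ∀ i ∈ X.honest, ∃ w, X.TcvOutput i w
  agreement : ∀ i ∈ X.honest, ∀ j ∈ X.honest, ∀ v w, X.TcvOutput i v → X.TcvOutput j w → v = w

/-- When an honest party obtains `pace_e`, it is not smaller than the slot number of the latest
finalized block `log[-1]` of that party (in epoch `e`). -/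
def PaceNotBehind (X : Execution par Tx Pf) : Prop :=
  ∀ i ∈ X.honest, ∀ t p b, (X.state t i).pace = none → (X.state (t + 1) i).pace = some p →
    (X.state t i).log.getLast? = some b → b.epoch = par.e → b.slot ≤ p

/-- No finalized block is revoked: a block is never removed from the log of an honest party, and
the slot of a block of epoch `e` that any honest party has finalized at any time is covered by the
`pace_e` of every honest party. -/
def NoRevocation (X : Execution par Tx Pf) : Prop :=
  (∀ i ∈ X.honest, ∀ t t', t ≤ t' → (X.state t i).log <+: (X.state t' i).log) ∧
  ∀ i ∈ X.honest, ∀ j ∈ X.honest, ∀ t t' p b, (X.state t i).pace = some p →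
    b ∈ (X.state t' j).log → b.epoch = par.e → b.slot ≤ p

end Execution

/-- The property `A`, depending on the security parameter `κ` and on the randomness `ω`, holds
except with negligible probability in `κ`. -/
def ExceptNegligible {Ω : ℕ → Type*} [∀ κ, MeasurableSpace (Ω κ)] (P : ∀ κ, MeasureTheory.Measure (Ω κ))
    (A : ∀ κ, Ω κ → Prop) : Prop :=
  Asymptotics.SuperpolynomialDecay Filter.atTop (fun κ : ℕ => (κ : ℝ))
    (fun κ => (P κ).real {ω | ¬ A κ ω})

end BDT

/-! The heart is the inequality `currentPace_le_tcvInput`: when an honest party delivers a block,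
the slot of its `1-notarized` block is at most every honest input to `tcv-BA[e]`. By notarizability
and total order, `f + 1` honest parties already hold an output extending that of the delivering
party. An honest input is the maximum over `n - f` senders, and `(f + 1) + (n - f) > n`, so one of
these holders is a sender. Its `1-notarized` slot is at least that of the delivering party, because
the notarized state is a function of the delivered list (`state_eq_boltState`) and its pace grows
with that list (`boltState_pace_mono`). Slots must be compared this way, not by counting, since
repeated transactions cause blocks to be skipped. A block finalized upon delivery was `2-notarized`,
hence lies strictly below `1-notarized`. By strong validity the agreed value `v` is an honest input,
so the strict inequality absorbs the subtraction in `v - 1`. Blocks appended during the sync are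
covered by the party's own pace, and agreement makes all paces equal. -/

namespace BDT

/-! ### Transitions of a single party and states determined by a delivered list. -/

section Local

variable {n : ℕ} {Tx Pf : Type*}

/-- The state reached from the initial one by processing a list of delivered blocks. -/
def boltState [DecidableEq Tx] (n : ℕ) (log₀ l : List (Block Tx Pf)) : LocalState n Tx Pf :=
  l.foldl LocalState.onDeliver (.init log₀)

/-- The slots of the blocks in the list are `1, 2, 3, …`. -/
def ConsecutiveSlots (l : List (Block Tx Pf)) : Prop :=
  ∀ (k : ℕ) (b : Block Tx Pf), l[k]? = some b → b.slot = k + 1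

theorem ConsecutiveSlots.of_prefix {l l' : List (Block Tx Pf)} (h : ConsecutiveSlots l')
    (hl : l <+: l') : ConsecutiveSlots l := by
  intro k b hb
  obtain ⟨r, rfl⟩ := hl
  refine h k b ?_
  rw [List.getElem?_append_left (List.getElem?_eq_some_iff.1 hb).1, hb]

theorem ConsecutiveSlots.slot_last {l : List (Block Tx Pf)} {d : Block Tx Pf}
    (h : ConsecutiveSlots (l ++ [d])) : d.slot = l.length + 1 :=
  h l.length d (by simp)

theorem onInterrupt_cases (s : LocalState n Tx Pf) :
    s.onInterrupt = s ∨
      s.paceMsg = none ∧ s.onInterrupt = { s with paceMsg := some s.currentPace } := by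
  unfold LocalState.onInterrupt
  split
  · exact .inr ⟨‹_›, rfl⟩
  · exact .inl rfl

theorem onReturn_cases (s : LocalState n Tx Pf) (v : ℕ) :
    s.onReturn v = s ∨ s.maxpace.isSome ∧ s.pace = none ∧
      s.onReturn v = { s with pace := some (v - 1), log := s.log ++ s.syncBlocks (v - 1) } := by
  unfold LocalState.onReturn
  split
  · exact .inr ⟨by simp [*], ‹_›, rfl⟩
  · exact .inl rfl

/-- Receiving a `PaceSync` message either leaves the recorded slots alone, or records one of a new
sender, after which the Transformer phase may be entered. -/
theorem onPace_cases (verify : ℕ → ℕ → Pf → Bool) (e quorum : ℕ) (s : LocalState n Tx Pf)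
    (j : Fin n) (p : ℕ) (π : Option Pf) :
    ∃ H S' m, s.onPace verify e quorum j p π = { s with heard := H, S := S', maxpace := m } ∧
      s.heard ⊆ H ∧ (S' = s.S ∧ m = s.maxpace ∨
        j ∉ s.heard ∧ j ∈ H ∧ S' = insert (j, p) s.S ∧
          (m = s.maxpace ∨ S'.card = quorum ∧ m = some (S'.sup Prod.snd))) := by
  unfold LocalState.onPace LocalState.record
  dsimp only
  split_ifs with h1 h2 h3
  · exact ⟨s.heard, s.S, s.maxpace, rfl, subset_rfl, .inl ⟨rfl, rfl⟩⟩
  · exact ⟨_, _, _, rfl, Finset.subset_insert _ _,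
      .inr ⟨h1, Finset.mem_insert_self _ _, rfl, .inr ⟨h3, rfl⟩⟩⟩
  · exact ⟨_, _, _, rfl, Finset.subset_insert _ _,
      .inr ⟨h1, Finset.mem_insert_self _ _, rfl, .inl rfl⟩⟩
  · exact ⟨_, _, _, rfl, Finset.subset_insert _ _, .inl ⟨rfl, rfl⟩⟩

/-- The only delicate case is pace one below the `1-notarized` slot: only the `2-notarized` block is
appended, and its slot is strictly smaller. -/
theorem slot_le_of_mem_syncBlocks {s : LocalState n Tx Pf} {p : ℕ} {b : Block Tx Pf}
    (h : ∀ c, s.two = some c → ∃ o, s.one = some o ∧ c.slot < o.slot)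
    (hb : b ∈ s.syncBlocks p) : b.slot ≤ p := by
  unfold LocalState.syncBlocks at hb
  split at hb
  · rename_i c o h2 h1
    obtain ⟨o', ho', hlt⟩ := h c h2
    obtain rfl : o = o' := by simpa [h1] using ho'
    split_ifs at hb <;> simp at hb
    · subst hb; omega
    · rcases hb with rfl | rfl <;> omega
  · simp at hb

variable [DecidableEq Tx]

theorem boltState_append_singleton (log₀ l : List (Block Tx Pf)) (d : Block Tx Pf) :
    boltState n log₀ (l ++ [d]) = (boltState n log₀ l).onDeliver d := by
  simp [boltState]

theorem onDeliver_cases (s : LocalState n Tx Pf) (d : Block Tx Pf) :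
    s.onDeliver d = s ∨
      s.onDeliver d = { s with log := s.log ++ s.two.toList, two := s.one, one := some d } := by
  unfold LocalState.onDeliver
  split_ifs
  · right
    rcases h : s.two with _ | c <;> simp
  · exact .inl rfl

/-- Slots of the notarized blocks after delivering consecutive blocks. -/
theorem boltState_slots (log₀ l : List (Block Tx Pf)) (h : ConsecutiveSlots l) :
    (boltState n log₀ l).currentPace.1 ≤ l.length ∧
      ∀ c, (boltState n log₀ l).two = some c →
        ∃ o, (boltState n log₀ l).one = some o ∧ c.slot < o.slot := by
  induction l using List.reverseRecOn with
  | nil => simp [boltState, LocalState.init, LocalState.currentPace]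
  | append_singleton l d ih =>
    obtain ⟨h1, h2⟩ := ih (h.of_prefix (List.prefix_append _ _))
    have hd := h.slot_last
    rw [boltState_append_singleton]
    rcases onDeliver_cases (boltState n log₀ l) d with e | e <;> rw [e]
    · exact ⟨by simp; omega, h2⟩
    · refine ⟨by simp [LocalState.currentPace, hd], fun c hc => ⟨d, rfl, ?_⟩⟩
      have hc' : (boltState n log₀ l).one = some c := hc
      -- The new `2-notarized` block is the old `1-notarized` one, whose slot is at most `l.length`,
      -- while `d` has slot `l.length + 1`.
      simp only [LocalState.currentPace, hc'] at h1
      omega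

/-- An ignored block leaves the pace alone; an accepted one has a slot above the number of blocks
delivered before, which bounds the old pace. -/
theorem boltState_pace_mono (log₀ : List (Block Tx Pf)) {l l' : List (Block Tx Pf)}
    (h : ConsecutiveSlots l') (hl : l <+: l') :
    (boltState n log₀ l).currentPace.1 ≤ (boltState n log₀ l').currentPace.1 := by
  obtain ⟨r, rfl⟩ := hl
  induction r using List.reverseRecOn with
  | nil => simp
  | append_singleton r d ih =>
    rw [← List.append_assoc] at h ⊢
    have h' := h.of_prefix (List.prefix_append _ _)
    refine (ih h').trans ?_
    have hle := (boltState_slots (n := n) log₀ _ h').1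
    have hd := h.slot_last
    rw [boltState_append_singleton]
    rcases onDeliver_cases (boltState n log₀ (l ++ r)) d with e | e <;> rw [e]
    refine hle.trans ?_
    simp only [LocalState.currentPace]
    omega

/-- Whether a block is ignored depends only on these three fields, so the remaining ones can be
dropped when comparing with `boltState`. -/
theorem onDeliver_congr {s s' : LocalState n Tx Pf} (d : Block Tx Pf) (hl : s.log = s'.log)
    (h2 : s.two = s'.two) (h1 : s.one = s'.one) :
    (s.onDeliver d).log = (s'.onDeliver d).log ∧ (s.onDeliver d).two = (s'.onDeliver d).two ∧
      (s.onDeliver d).one = (s'.onDeliver d).one := by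
  unfold LocalState.onDeliver LocalState.knownTxs
  rw [hl, h2, h1]
  split_ifs
  · rcases h : s'.two with _ | c <;> simp
  · exact ⟨hl, h2, h1⟩


theorem onDeliver_log_prefix (s : LocalState n Tx Pf) (d : Block Tx Pf) :
    s.log <+: (s.onDeliver d).log := by
  rcases onDeliver_cases s d with e | e <;> rw [e]
  exact List.prefix_append _ _

theorem onDeliver_other (s : LocalState n Tx Pf) (d : Block Tx Pf) :
    (s.onDeliver d).paceMsg = s.paceMsg ∧ (s.onDeliver d).heard = s.heard ∧
      (s.onDeliver d).S = s.S ∧ (s.onDeliver d).maxpace = s.maxpace ∧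
      (s.onDeliver d).pace = s.pace := by
  rcases onDeliver_cases s d with e | e <;> rw [e] <;> simp

end Local

/-! ### Persistence of logs, messages and paces along an execution. -/

namespace Execution

variable {par : Params} {Tx Pf : Type*} [DecidableEq Tx] {X : Execution par Tx Pf}

/-- The ways in which the local state of a party can change. -/
theorem state_succ_cases (X : Execution par Tx Pf) (t : ℕ) (i : Fin par.n) :
    X.state (t + 1) i = X.state t i ∧ X.boltLog (t + 1) i = X.boltLog t i ∨
    (∃ b, X.event t = .deliver i b ∧ X.state (t + 1) i = (X.state t i).onDeliver b ∧
      X.boltLog (t + 1) i = X.boltLog t i ++ [b]) ∨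
    (X.state (t + 1) i = (X.state t i).onInterrupt ∧ X.boltLog (t + 1) i = X.boltLog t i) ∨
    (∃ j p π, X.event t = .recvPace i j p π ∧
      X.state (t + 1) i = (X.state t i).onPace X.verify par.e (par.n - par.f) j p π ∧
      X.boltLog (t + 1) i = X.boltLog t i) ∨
    ∃ v, X.event t = .tcvReturn i v ∧ X.state (t + 1) i = (X.state t i).onReturn v ∧
      X.boltLog (t + 1) i = X.boltLog t i := by
  simp only [state, boltLog]
  cases h : X.event t with
  | deliver k b => by_cases hk : k = i <;> simp [LocalState.step, hk]
  | interrupt k => by_cases hk : k = i <;> simp [LocalState.step, hk]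
  | recvPace k j p π =>
    by_cases hk : k = i
    · subst hk; right; right; right; left; exact ⟨j, p, π, rfl, by simp [LocalState.step], rfl⟩
    · simp [LocalState.step, hk]
  | tcvReturn k v => by_cases hk : k = i <;> simp [LocalState.step, hk]
  | idle => simp [LocalState.step]

theorem boltLog_mono (X : Execution par Tx Pf) (i : Fin par.n) {t t' : ℕ} (h : t ≤ t') :
    X.boltLog t i <+: X.boltLog t' i := by
  induction t', h using Nat.le_induction with
  | base => exact List.prefix_rfl
  | succ t' _ ih =>
    refine ih.trans ?_
    rcases X.state_succ_cases t' i with h | ⟨b, h⟩ | h | ⟨j, p, π, h⟩ | ⟨v, h⟩ <;> simp [h]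

theorem log_mono (X : Execution par Tx Pf) (i : Fin par.n) {t t' : ℕ} (h : t ≤ t') :
    (X.state t i).log <+: (X.state t' i).log := by
  induction t', h using Nat.le_induction with
  | base => exact List.prefix_rfl
  | succ t' _ ih =>
    refine ih.trans ?_
    rcases X.state_succ_cases t' i with ⟨h, -⟩ | ⟨b, -, h, -⟩ | ⟨h, -⟩ | ⟨j, p, π, -, h, -⟩ |
      ⟨v, -, h, -⟩ <;> rw [h]
    · exact onDeliver_log_prefix _ _
    · rcases onInterrupt_cases (X.state t' i) with e | ⟨-, e⟩ <;> rw [e]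
    · obtain ⟨H, S', m, e, -⟩ := onPace_cases X.verify par.e (par.n - par.f) (X.state t' i) j p π
      rw [e]
    · rcases onReturn_cases (X.state t' i) v with e | ⟨-, -, e⟩ <;> rw [e]
      exact List.prefix_append _ _

theorem paceMsg_mono (X : Execution par Tx Pf) (i : Fin par.n) {t t' : ℕ} (h : t ≤ t')
    {m : ℕ × Option Pf} (hm : (X.state t i).paceMsg = some m) :
    (X.state t' i).paceMsg = some m := by
  induction t', h using Nat.le_induction with
  | base => exact hm
  | succ t' _ ih =>
    rcases X.state_succ_cases t' i with ⟨h, -⟩ | ⟨b, -, h, -⟩ | ⟨h, -⟩ | ⟨j, p, π, -, h, -⟩ |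
      ⟨v, -, h, -⟩ <;> rw [h]
    · exact ih
    · rw [(onDeliver_other _ _).1, ih]
    · rcases onInterrupt_cases (X.state t' i) with e | ⟨e', e⟩
      · rw [e, ih]
      · simp [ih] at e'
    · obtain ⟨H, S', m, e, -⟩ := onPace_cases X.verify par.e (par.n - par.f) (X.state t' i) j p π
      rw [e, ih]
    · rcases onReturn_cases (X.state t' i) v with e | ⟨-, -, e⟩ <;> rw [e, ih]

/-- An obtained pace comes from an output of `tcv-BA[e]`, in the Transformer phase. -/
theorem pace_eq_some (X : Execution par Tx Pf) (i : Fin par.n) (t : ℕ) {p : ℕ}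
    (hp : (X.state t i).pace = some p) :
    (∃ v, X.TcvOutput i v ∧ p = v - 1) ∧ (X.state t i).maxpace.isSome := by
  induction t with
  | zero => simp [state, LocalState.init] at hp
  | succ t ih =>
    rcases X.state_succ_cases t i with ⟨h, -⟩ | ⟨b, -, h, -⟩ | ⟨h, -⟩ | ⟨j, q, π, -, h, -⟩ |
      ⟨v, hv, h, -⟩ <;> rw [h] at hp ⊢
    · exact ih hp
    · rw [(onDeliver_other _ _).2.2.2.2] at hp
      rw [(onDeliver_other _ _).2.2.2.1]
      exact ih hp
    · rcases onInterrupt_cases (X.state t i) with e | ⟨-, e⟩ <;> rw [e] at hp ⊢ <;> exact ih hp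
    · obtain ⟨H, S', m, e, -, ⟨-, rfl⟩ | ⟨-, -, -, rfl | ⟨-, rfl⟩⟩⟩ :=
        onPace_cases X.verify par.e (par.n - par.f) (X.state t i) j q π <;> rw [e] at hp ⊢
      · exact ih hp
      · exact ih hp
      · exact ⟨(ih hp).1, rfl⟩
    · rcases onReturn_cases (X.state t i) v with e | ⟨hm, -, e⟩ <;> rw [e] at hp ⊢
      · exact ih hp
      · exact ⟨⟨v, ⟨t, hv⟩, (Option.some.inj hp).symm⟩, hm⟩

/-! ### Recorded slots and quorums of senders. -/

/-- The recorded slots: one per sender, and the ones of honest senders are those they sent. -/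
theorem recorded (hX : X.Admissible) {i : Fin par.n} (hi : i ∈ X.honest) (t : ℕ) :
    (∀ x ∈ (X.state t i).S, x.1 ∈ (X.state t i).heard ∧
      (x.1 ∈ X.honest → ∃ π, (X.state t x.1).paceMsg = some (x.2, π))) ∧
    Set.InjOn Prod.fst ((X.state t i).S : Set (Fin par.n × ℕ)) := by
  induction t with
  | zero => simp [state, LocalState.init]
  | succ t ih =>
    have key : ∀ x ∈ (X.state t i).S, x.1 ∈ (X.state t i).heard ∧
        (x.1 ∈ X.honest → ∃ π, (X.state (t + 1) x.1).paceMsg = some (x.2, π)) := fun x hx =>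
      ⟨(ih.1 x hx).1, fun hh => ((ih.1 x hx).2 hh).imp fun _ => X.paceMsg_mono _ t.le_succ⟩
    have hinj := ih.2
    rcases X.state_succ_cases t i with ⟨h, -⟩ | ⟨b, -, h, -⟩ | ⟨h, -⟩ | ⟨j, q, π, hev, h, -⟩ |
      ⟨v, -, h, -⟩
    · rw [h]; exact ⟨key, hinj⟩
    · rw [h, (onDeliver_other _ _).2.1, (onDeliver_other _ _).2.2.1]; exact ⟨key, hinj⟩
    · rcases onInterrupt_cases (X.state t i) with e | ⟨-, e⟩ <;> rw [h, e] <;> exact ⟨key, hinj⟩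
    · obtain ⟨H, S', m, e, hH, ⟨rfl, -⟩ | ⟨hj, hjH, rfl, -⟩⟩ :=
        onPace_cases X.verify par.e (par.n - par.f) (X.state t i) j q π <;> rw [h, e]
      · exact ⟨fun x hx => ⟨hH (key x hx).1, (key x hx).2⟩, hinj⟩
      · dsimp only
        constructor
        · intro x hx
          rcases Finset.mem_insert.1 hx with rfl | hx
          · exact ⟨hjH, fun hh =>
              ⟨π, X.paceMsg_mono _ t.le_succ (hX.authenticated t i _ _ _ hi hh hev)⟩⟩
          · exact ⟨hH (key x hx).1, (key x hx).2⟩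
        -- A recorded sender has been heard, so a sender not yet heard cannot collide with an
        -- earlier entry.
        · have hjS : (j, q) ∉ (X.state t i).S := fun hx => hj (key _ hx).1
          rw [Finset.coe_insert, Set.injOn_insert (by simpa using hjS)]
          refine ⟨hinj, ?_⟩
          rintro ⟨x, hx, hxj⟩
          have hxj' : x.1 = j := hxj
          exact hj (hxj' ▸ (key x hx).1)
    · rcases onReturn_cases (X.state t i) v with e | ⟨-, -, e⟩ <;> rw [h, e] <;>
        exact ⟨key, hinj⟩

/-- The input of an honest party to `tcv-BA[e]` is an upper bound on the slots sent by the honest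
members of a quorum. -/
theorem exists_quorum (hX : X.Admissible) {i : Fin par.n} (hi : i ∈ X.honest) (t : ℕ) {v : ℕ}
    (hv : (X.state t i).maxpace = some v) :
    ∃ T : Finset (Fin par.n), T.card = par.n - par.f ∧
      ∀ j ∈ T, j ∈ X.honest → ∃ p ≤ v, ∃ π, (X.state t j).paceMsg = some (p, π) := by
  induction t with
  | zero => simp [state, LocalState.init] at hv
  | succ t ih =>
    have key (hv : (X.state t i).maxpace = some v) : ∃ T : Finset (Fin par.n),
        T.card = par.n - par.f ∧ ∀ j ∈ T, j ∈ X.honest →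
          ∃ p ≤ v, ∃ π, (X.state (t + 1) j).paceMsg = some (p, π) := by
      obtain ⟨T, hT, h⟩ := ih hv
      refine ⟨T, hT, fun j hj hh => ?_⟩
      obtain ⟨p, hp, π, hm⟩ := h j hj hh
      exact ⟨p, hp, π, X.paceMsg_mono _ t.le_succ hm⟩
    have hrec := recorded hX hi (t + 1)
    rcases X.state_succ_cases t i with ⟨h, -⟩ | ⟨b, -, h, -⟩ | ⟨h, -⟩ | ⟨j, q, π, -, h, -⟩ |
      ⟨w, -, h, -⟩ <;> rw [h] at hv
    · exact key hv
    · rw [(onDeliver_other _ _).2.2.2.1] at hv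
      exact key hv
    · rcases onInterrupt_cases (X.state t i) with e | ⟨-, e⟩ <;> rw [e] at hv <;> exact key hv
    · obtain ⟨H, S', m, e, -, ⟨-, rfl⟩ | ⟨-, -, -, rfl | ⟨hcard, rfl⟩⟩⟩ :=
        onPace_cases X.verify par.e (par.n - par.f) (X.state t i) j q π <;> rw [e] at hv
      · exact key hv
      · exact key hv
      · obtain rfl := Option.some.inj hv
        rw [h, e] at hrec
        refine ⟨S'.image Prod.fst, by rw [Finset.card_image_of_injOn hrec.2, hcard], ?_⟩
        intro k hk hh
        obtain ⟨x, hx, rfl⟩ := Finset.mem_image.1 hk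
        exact ⟨x.2, Finset.le_sup (f := Prod.snd) hx, (hrec.1 x hx).2 hh⟩
    · rcases onReturn_cases (X.state t i) w with e | ⟨-, -, e⟩ <;> rw [e] at hv <;> exact key hv

/-! ### The state of an honest party as a function of its Bolt output. -/

theorem consecutiveSlots (hB : X.BoltSecure) {i : Fin par.n} (hi : i ∈ X.honest) (t : ℕ) :
    ConsecutiveSlots (X.boltLog t i) :=
  fun k b h => (hB.wellFormed i hi t k b h).2

/-- A block delivered to an honest party is valid and has the next slot. -/
theorem deliver_valid (hB : X.BoltSecure) {i : Fin par.n} (hi : i ∈ X.honest) {t : ℕ}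
    {d : Block Tx Pf} (hd : X.event t = .deliver i d) :
    X.ValidBlock d ∧ d.slot = (X.boltLog t i).length + 1 :=
  hB.wellFormed i hi (t + 1) _ d (by simp [boltLog, hd])

/-- In the Transformer phase, honest parties deliver nothing any more. -/
theorem maxpace_eq_none_of_deliver (hX : X.Admissible) (hB : X.BoltSecure) {i : Fin par.n}
    (hi : i ∈ X.honest) {t : ℕ} {d : Block Tx Pf} (hd : X.event t = .deliver i d) :
    (X.state t i).maxpace = none := by
  by_contra hne
  obtain ⟨v, hv⟩ := Option.ne_none_iff_exists'.1 hne
  obtain ⟨T, hT, h⟩ := exists_quorum hX hi t hv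
  refine hB.abandon_all t (T ∩ X.honest) Finset.inter_subset_right ?_ ?_ i d hd
    (deliver_valid hB hi hd).1
  -- At most `f` of the `n - f` senders are corrupted, and `n - 2f ≥ f + 1`.
  · have h1 : T.card ≤ (T ∩ X.honest).card + X.honestᶜ.card := by
      refine le_trans (Finset.card_le_card ?_) (Finset.card_union_le _ _)
      intro x hx
      by_cases hh : x ∈ X.honest <;> simp [hx, hh]
    have := hX.corrupted_le
    have := par.resilience
    omega
  · intro k hk
    obtain ⟨hkT, hkh⟩ := Finset.mem_inter.1 hk
    obtain ⟨p, -, π, hm⟩ := h k hkT hkh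
    simp [Abandoned, hm]

/-- The notarized blocks of an honest party, and its log as long as it has no pace, are determined
by the blocks it has delivered. -/
theorem state_eq_boltState (hX : X.Admissible) (hB : X.BoltSecure) {i : Fin par.n}
    (hi : i ∈ X.honest) (t : ℕ) :
    (X.state t i).two = (boltState par.n X.log₀ (X.boltLog t i)).two ∧
    (X.state t i).one = (boltState par.n X.log₀ (X.boltLog t i)).one ∧
    ((X.state t i).pace = none →
      (X.state t i).log = (boltState par.n X.log₀ (X.boltLog t i)).log) := by
  induction t with
  | zero => simp [state, boltLog, boltState]
  | succ t ih =>
    rcases X.state_succ_cases t i with ⟨h, h'⟩ | ⟨b, hb, h, h'⟩ | ⟨h, h'⟩ | ⟨j, p, π, -, h, h'⟩ |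
      ⟨v, -, h, h'⟩ <;> rw [h, h']
    · exact ih
    -- A sync could change the log and thereby which blocks count as new; but a party with a pace is
    -- in the Transformer phase, where no delivery occurs.
    · have hp : (X.state t i).pace = none := by
        by_contra hne
        obtain ⟨p, hp⟩ := Option.ne_none_iff_exists'.1 hne
        simpa [maxpace_eq_none_of_deliver hX hB hi hb] using (X.pace_eq_some i t hp).2
      obtain ⟨h1, h2, h3⟩ := onDeliver_congr b (ih.2.2 hp) ih.1 ih.2.1
      rw [boltState_append_singleton]
      exact ⟨h2, h3, fun _ => h1⟩
    · rcases onInterrupt_cases (X.state t i) with e | ⟨-, e⟩ <;> rw [e] <;> exact ih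
    · obtain ⟨H, S', m, e, -⟩ := onPace_cases X.verify par.e (par.n - par.f) (X.state t i) j p π
      rw [e]; exact ih
    · rcases onReturn_cases (X.state t i) v with e | ⟨-, -, e⟩ <;> rw [e]
      · exact ih
      · exact ⟨ih.1, ih.2.1, fun h => by simp at h⟩

theorem currentPace_eq_boltState (hX : X.Admissible) (hB : X.BoltSecure) {i : Fin par.n}
    (hi : i ∈ X.honest) (t : ℕ) :
    (X.state t i).currentPace = (boltState par.n X.log₀ (X.boltLog t i)).currentPace := by
  simp [LocalState.currentPace, (state_eq_boltState hX hB hi t).2.1]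

/-- The slot that an honest party has sent is still that of its `1-notarized` block. -/
theorem paceMsg_eq_currentPace (hB : X.BoltSecure) {i : Fin par.n} (hi : i ∈ X.honest) (t : ℕ)
    {m : ℕ × Option Pf} (hm : (X.state t i).paceMsg = some m) :
    (X.state t i).currentPace = m := by
  induction t with
  | zero => simp [state, LocalState.init] at hm
  | succ t ih =>
    rcases X.state_succ_cases t i with ⟨h, -⟩ | ⟨b, hb, h, -⟩ | ⟨h, -⟩ | ⟨j, p, π, -, h, -⟩ |
      ⟨v, -, h, -⟩ <;> rw [h] at hm ⊢
    · exact ih hm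
    · rw [(onDeliver_other _ _).1] at hm
      exact absurd hb (hB.abandon_self t i hi (by simp [Abandoned, hm]) b)
    · rcases onInterrupt_cases (X.state t i) with e | ⟨-, e⟩ <;> rw [e] at hm ⊢
      · exact ih hm
      · exact Option.some.inj hm
    · obtain ⟨H, S', m, e, -⟩ := onPace_cases X.verify par.e (par.n - par.f) (X.state t i) j p π
      rw [e] at hm ⊢; exact ih hm
    · rcases onReturn_cases (X.state t i) v with e | ⟨-, -, e⟩ <;> rw [e] at hm ⊢ <;> exact ih hm

theorem two_slot_lt_one (hX : X.Admissible) (hB : X.BoltSecure) {i : Fin par.n}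
    (hi : i ∈ X.honest) (t : ℕ) (c : Block Tx Pf) (hc : (X.state t i).two = some c) :
    ∃ o, (X.state t i).one = some o ∧ c.slot < o.slot := by
  obtain ⟨h2, h1, -⟩ := state_eq_boltState hX hB hi t
  rw [h1]
  exact (boltState_slots X.log₀ _ (consecutiveSlots hB hi t)).2 c (h2 ▸ hc)

/-! ### Finalized blocks against the inputs to `tcv-BA[e]`. -/

/-- How a block gets into the log of an honest party: it is there from the beginning, or it is
finalized upon a delivery, when its slot is smaller than that of the `1-notarized` block, or it is
covered by the pace that the party has obtained. -/
theorem mem_log (hX : X.Admissible) (hB : X.BoltSecure) {i : Fin par.n} (hi : i ∈ X.honest) (t : ℕ)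
    {b : Block Tx Pf} (hb : b ∈ (X.state t i).log) :
    b ∈ X.log₀ ∨
    (∃ t' d, X.event t' = .deliver i d ∧ b.slot < (X.state t' i).currentPace.1) ∨
    ∃ p, (X.state t i).pace = some p ∧ b.slot ≤ p := by
  induction t with
  | zero => exact .inl hb
  | succ t ih =>
    rcases X.state_succ_cases t i with ⟨h, -⟩ | ⟨d, hd, h, -⟩ | ⟨h, -⟩ | ⟨j, p, π, -, h, -⟩ |
      ⟨v, -, h, -⟩ <;> rw [h] at hb ⊢
    · exact ih hb
    · rw [(onDeliver_other _ _).2.2.2.2]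
      rcases onDeliver_cases (X.state t i) d with e | e <;> rw [e] at hb
      · exact ih hb
      · rcases List.mem_append.1 hb with hb | hb
        · exact ih hb
        · obtain ⟨o, ho, hlt⟩ := two_slot_lt_one hX hB hi t b (by simpa using hb)
          exact .inr (.inl ⟨t, d, hd, by simpa [LocalState.currentPace, ho] using hlt⟩)
    · rcases onInterrupt_cases (X.state t i) with e | ⟨-, e⟩ <;> rw [e] at hb ⊢ <;> exact ih hb
    · obtain ⟨H, S', m, e, -⟩ := onPace_cases X.verify par.e (par.n - par.f) (X.state t i) j p π
      rw [e] at hb ⊢; exact ih hb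
    · rcases onReturn_cases (X.state t i) v with e | ⟨-, hp, e⟩ <;> rw [e] at hb ⊢
      · exact ih hb
      · rcases List.mem_append.1 hb with hb | hb
        · rcases ih hb with h | h | ⟨p, h, -⟩
          · exact .inl h
          · exact .inr (.inl h)
          · simp [hp] at h
        · exact .inr (.inr ⟨v - 1, rfl,
            slot_le_of_mem_syncBlocks (two_slot_lt_one hX hB hi t) hb⟩)

/-- When an honest party delivers a block, the slot of its `1-notarized` block is at most every
input of an honest party to `tcv-BA[e]`. -/
theorem currentPace_le_tcvInput (hX : X.Admissible) (hB : X.BoltSecure) {i k : Fin par.n}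
    (hi : i ∈ X.honest) (hk : k ∈ X.honest) {t v : ℕ} {d : Block Tx Pf}
    (hd : X.event t = .deliver i d) (hv : X.TcvInput k v) :
    (X.state t i).currentPace.1 ≤ v := by
  obtain ⟨hval, hslot⟩ := deliver_valid hB hi hd
  rw [currentPace_eq_boltState hX hB hi]
  have hle := (boltState_slots (n := par.n) X.log₀ _ (consecutiveSlots hB hi t)).1
  rcases Nat.eq_zero_or_pos (X.boltLog t i).length with h0 | hpos
  -- Before the first delivery the pace is `0`; notarizability only speaks of slots at least `2`.
  · omega
  obtain ⟨Q, hQh, hQ, hout⟩ := hB.notarizability t i d hd hval (by omega)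
  obtain ⟨u, hu⟩ := hv
  obtain ⟨T, hT, hsent⟩ := exists_quorum hX hk u hu
  obtain ⟨q, hq⟩ : (Q ∩ T).Nonempty := by
    rw [← Finset.card_pos]
    have h1 := Finset.card_union_add_card_inter Q T
    have h2 : (Q ∪ T).card ≤ par.n := by simpa using Finset.card_le_univ (Q ∪ T)
    have := par.resilience
    omega
  obtain ⟨hqQ, hqT⟩ := Finset.mem_inter.1 hq
  have hqh := hQh hqQ
  obtain ⟨p, hp, π, hm⟩ := hsent q hqT hqh
  obtain ⟨b', hb', -, hb's⟩ := hout q hqQ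
  -- Slots are consecutive, so an output containing the preceding slot is at least as long as that
  -- of `i`.
  have hlen : (X.boltLog t i).length ≤ (X.boltLog t q).length := by
    obtain ⟨r, hr⟩ := List.mem_iff_getElem?.1 hb'
    have h1 := consecutiveSlots hB hqh t r b' hr
    have h2 := (List.getElem?_eq_some_iff.1 hr).1
    omega
  have hpre : X.boltLog t i <+: X.boltLog t q := by
    rw [List.prefix_iff_getElem?]
    intro r hr
    rw [List.getElem?_eq_getElem (hr.trans_le hlen), Option.some_inj]
    exact hB.totalOrder q hqh i hi t t r _ _ (List.getElem?_eq_getElem _)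
      (List.getElem?_eq_getElem _)
  -- The message of `q` may precede or follow its relevant output. At time `max t u` both have
  -- happened, and abandoning has frozen its `1-notarized` block at the slot sent.
  have hm' := X.paceMsg_mono q (le_max_right t u) hm
  have hp' := paceMsg_eq_currentPace hB hqh _ hm'
  rw [currentPace_eq_boltState hX hB hqh] at hp'
  have := boltState_pace_mono (n := par.n) X.log₀ (consecutiveSlots hB hqh (max t u))
    (hpre.trans (X.boltLog_mono q (le_max_left t u)))
  rw [hp'] at this
  exact this.trans hp

theorem noRevocation (hX : X.Admissible) (hB : X.BoltSecure) (hT : X.TcvBASecure) :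
    X.NoRevocation := by
  refine ⟨fun i _ t t' h => X.log_mono i h, fun i hi j hj t t' p b hp hb he => ?_⟩
  obtain ⟨⟨v, hv, rfl⟩, -⟩ := X.pace_eq_some i t hp
  rcases mem_log hX hB hj t' hb with h | ⟨s, d, hd, hlt⟩ | ⟨p, hp', hle⟩
  · exact absurd he (hX.earlier b h).ne
  · obtain ⟨k, hk, hin⟩ := hT.strongValidity i hi v hv
    have := currentPace_le_tcvInput hX hB hj hk hd hin
    omega
  · obtain ⟨⟨w, hw, rfl⟩, -⟩ := X.pace_eq_some j t' hp'
    rwa [hT.agreement i hi j hj v w hv hw]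

/-- This is the covering half of `NoRevocation` for one party, with the log taken just before the
pace is obtained. -/
theorem NoRevocation.paceNotBehind (h : X.NoRevocation) : X.PaceNotBehind :=
  fun i hi t p b _ hp hb he =>
    h.2 i hi i hi (t + 1) t p b hp (List.mem_of_getLast? hb) he

end Execution

/-! ### From single executions to negligible probability, by a union bound. -/

theorem ExceptNegligible.of_and {Ω : ℕ → Type*} [∀ κ, MeasurableSpace (Ω κ)]
    {P : ∀ κ, MeasureTheory.Measure (Ω κ)} [∀ κ, MeasureTheory.IsFiniteMeasure (P κ)]
    {A B C : ∀ κ, Ω κ → Prop} (hA : ExceptNegligible P A) (hB : ExceptNegligible P B)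
    (h : ∀ κ ω, A κ ω → B κ ω → C κ ω) : ExceptNegligible P C := by
  refine (Asymptotics.SuperpolynomialDecay.add hA hB).trans_abs_le fun κ => ?_
  refine abs_le_abs_of_nonneg MeasureTheory.measureReal_nonneg ?_
  refine (MeasureTheory.measureReal_mono ?_).trans (MeasureTheory.measureReal_union_le _ _)
  intro ω hω
  by_contra hn
  simp only [Set.mem_union, Set.mem_ofPred_eq, not_or, not_not] at hn
  exact hω (h κ ω hn.1 hn.2)

end BDT

theorem mainTheorem3 {Tx Pf : Type*} [DecidableEq Tx]
    (par : ℕ → BDT.Params)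
    {Ω : ℕ → Type*} [∀ κ, MeasurableSpace (Ω κ)]
    (P : ∀ κ, MeasureTheory.Measure (Ω κ)) [∀ κ, MeasureTheory.IsProbabilityMeasure (P κ)]
    (X : ∀ κ, Ω κ → BDT.Execution (par κ) Tx Pf)
    (hadm : ∀ κ ω, (X κ ω).Admissible)
    (hBolt : BDT.ExceptNegligible P fun κ ω => (X κ ω).BoltSecure)
    (hTcv : BDT.ExceptNegligible P fun κ ω => (X κ ω).TcvBASecure) :
    BDT.ExceptNegligible P fun κ ω => (X κ ω).PaceNotBehind ∧ (X κ ω).NoRevocation := by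
  exact hBolt.of_and hTcv fun κ ω hB hT =>
    have h := BDT.Execution.noRevocation (hadm κ ω) hB hT
    ⟨h.paceNotBehind, h⟩
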